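/- Let $\Bbbk$ be a field, $A$ a Hopf algebra over $\Bbbk$ and $R$ a (unital, associative) $\Bbbk$-algebra. A partial action of a Hopf algebra $H$ on $R$ is a linear map $\cdot : H\otimes R\to R$ such that, for all $h,l\in H$ and $r,s\in R$ (with $\Delta(h)=h_1\otimes h_2$ in Sweedler notation), $$1_H\cdot r=r,\qquad h\cdot (rs)=(h_1\cdot r)(h_2\cdot s),\qquad h\cdot(l\cdot r)=(h_1\cdot 1_R)(h_2l\cdot r);$$ it is symmetric if moreover $h\cdot(l\cdot r)=(h_1l\cdot r)(h_2\cdot 1_R)$ for all $h,l\in H$, $r\in R$. Let $\sigma$ be an algebra automorphism of $A$ and $\delta: A\to A$ a $\sigma$-derivation, i.e. a linear map with $\delta(ab)=\delta(a)b+\sigma(a)\delta(b)$. The Ore extension $A[x,\sigma,\delta]$ is the algebra of the sums $\sum_i a_ix^i$ (finite sums, with unique coefficients $a_i\in A$) with multiplication determined by $xa=\sigma(a)x+\delta(a)$, $a\in A$. It is a Hopf-Ore extension of $A$ if it is equipped with a Hopf algebra structure which extends that of $A$ and satisfies $\Delta(x)=x\otimes 1+g\otimes x$ for some grouplike element $g\in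 A$. Proposition. Let $\cdot : A\otimes R\to R$ be a partial action, let $A[x,\sigma,\delta]$ be a Hopf-Ore extension of $A$, and let $J$ be the two-sided ideal of $A$ generated by $\delta(A)$. If $J\cdot R=0$, then there is exactly one linear map $\triangleright : A[x,\sigma,\delta]\otimes R\to R$ such that $$x^ja\triangleright r=\begin{cases} a\cdot r, & j=0,\\ 0, & j\geq 1,\end{cases}\qquad a\in A,\ r\in R,\ j\ge 0,$$ and this map is a partial action of $A[x,\sigma,\delta]$ on $R$; if $\cdot$ is symmetric, then so is $\triangleright$. In particular, if $A[x,\sigma]=A[x,\sigma,0]$ is a Hopf-Ore extension of $A$, then for every partial action $\cdot$ of $A$ on $R$ the same formula gives a well-defined partial action of $A[x,\sigma]$ on $R$, which is symmetric if $\cdot$ is symmetric. -/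

import Mathlib

open scoped TensorProduct

universe u v w

/-- A `σ`-derivation of the `k`-algebra `A`: a `k`-linear map `δ : A → A` such that
`δ (a b) = δ a * b + σ a * δ b`. -/
structure SkewDerivation {k : Type u} {A : Type v} [Field k] [Ring A] [Algebra k A]
    (σ : A ≃ₐ[k] A) where
  toLinearMap : A →ₗ[k] A
  map_mul : ∀ a b : A, toLinearMap (a * b) = toLinearMap a * b + σ a * toLinearMap b

instance SkewDerivation.instZero {k : Type u} {A : Type v} [Field k] [Ring A] [Algebra k A]
    (σ : A ≃ₐ[k] A) : Zero (SkewDerivation σ) where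
  zero := { toLinearMap := 0, map_mul := by intro a b; simp }

/-- The Ore extension `A[x, σ, δ]`: as a vector space it consists of the finite sums
`∑ aᵢ xⁱ` with `aᵢ ∈ A`, encoded by the finitely supported sequence of the `aᵢ`. The
multiplication, defined below, is the one with `x a = σ(a) x + δ(a)`. -/
def OreExtension {k : Type u} {A : Type v} [Field k] [Ring A] [Algebra k A]
    (σ : A ≃ₐ[k] A) (_δ : SkewDerivation σ) : Type v :=
  ℕ →₀ A

namespace OreExtension

section

variable {k : Type u} {A : Type v} [Field k] [Ring A] [Algebra k A]
  (σ : A ≃ₐ[k] A) (δ : SkewDerivation σ)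

noncomputable instance instAddCommGroup : AddCommGroup (OreExtension σ δ) :=
  inferInstanceAs (AddCommGroup (ℕ →₀ A))

noncomputable instance instModule : Module k (OreExtension σ δ) :=
  inferInstanceAs (Module k (ℕ →₀ A))

/-- Left multiplication by the variable:
`∑ aᵢ xⁱ ↦ ∑ σ(aᵢ) xⁱ⁺¹ + ∑ δ(aᵢ) xⁱ`. -/
noncomputable def shift : Module.End k (ℕ →₀ A) :=
  Finsupp.lmapDomain A k Nat.succ ∘ₗ Finsupp.mapRange.linearMap σ.toLinearMap +
    Finsupp.mapRange.linearMap δ.toLinearMap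

/-- Left multiplication by `∑ aᵢ xⁱ`, that is, `g ↦ ∑ aᵢ • shiftⁱ g`. -/
noncomputable def lmul : (ℕ →₀ A) →ₗ[k] Module.End k (ℕ →₀ A) :=
  Finsupp.lsum k fun i =>
    LinearMap.mulRight k (shift σ δ ^ i) ∘ₗ (Algebra.lsmul k k (ℕ →₀ A)).toLinearMap

theorem shift_single (i : ℕ) (a : A) :
    shift σ δ (Finsupp.single i a) =
      Finsupp.single (i + 1) (σ a) + Finsupp.single i (δ.toLinearMap a) := by
  simp [shift]

theorem shift_smul (a : A) (f : ℕ →₀ A) :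
    shift σ δ (a • f) = σ a • shift σ δ f + δ.toLinearMap a • f := by
  induction f using Finsupp.induction_linear with
  | zero => simp
  | add f g hf hg => simp only [smul_add, map_add, hf, hg]; abel
  | single i b =>
    rw [Finsupp.smul_single, shift_single, shift_single]
    simp [δ.map_mul, Finsupp.single_add]
    abel

theorem lmul_single (i : ℕ) (a : A) (g : ℕ →₀ A) :
    lmul σ δ (Finsupp.single i a) g = a • (shift σ δ ^ i) g := by
  simp [lmul]

theorem lmul_smul (a : A) (f g : ℕ →₀ A) : lmul σ δ (a • f) g = a • lmul σ δ f g := by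
  induction f using Finsupp.induction_linear with
  | zero => simp
  | add f f' hf hf' => simp only [smul_add, map_add, LinearMap.add_apply, hf, hf']
  | single i b => rw [Finsupp.smul_single, lmul_single, lmul_single, smul_eq_mul, mul_smul]

theorem lmul_shift (f g : ℕ →₀ A) :
    lmul σ δ (shift σ δ f) g = shift σ δ (lmul σ δ f g) := by
  induction f using Finsupp.induction_linear with
  | zero => simp
  | add f f' hf hf' => simp only [map_add, LinearMap.add_apply, hf, hf']
  | single i b =>
    rw [shift_single, map_add, LinearMap.add_apply, lmul_single, lmul_single, lmul_single,
      shift_smul, pow_succ', Module.End.mul_apply]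

theorem lmul_shift_pow (i : ℕ) (f g : ℕ →₀ A) :
    lmul σ δ ((shift σ δ ^ i) f) g = (shift σ δ ^ i) (lmul σ δ f g) := by
  induction i with
  | zero => simp
  | succ i ih => rw [pow_succ', Module.End.mul_apply, lmul_shift, ih, Module.End.mul_apply]

theorem lmul_lmul (f g h : ℕ →₀ A) :
    lmul σ δ (lmul σ δ f g) h = lmul σ δ f (lmul σ δ g h) := by
  induction f using Finsupp.induction_linear with
  | zero => simp
  | add f f' hf hf' => simp only [map_add, LinearMap.add_apply, hf, hf']
  | single i a => rw [lmul_single, lmul_single, lmul_smul, lmul_shift_pow]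

theorem shift_pow_one (i : ℕ) :
    (shift σ δ ^ i) (Finsupp.single 0 1) = Finsupp.single i 1 := by
  have h1 : δ.toLinearMap 1 = 0 := by simpa using δ.map_mul 1 1
  induction i with
  | zero => simp
  | succ i ih => rw [pow_succ', Module.End.mul_apply, ih, shift_single, h1]; simp

theorem lmul_one_right (f : ℕ →₀ A) : lmul σ δ f (Finsupp.single 0 1) = f := by
  induction f using Finsupp.induction_linear with
  | zero => simp
  | add f f' hf hf' => simp only [map_add, LinearMap.add_apply, hf, hf']
  | single i a => rw [lmul_single, shift_pow_one]; simp

theorem lmul_one_left (f : ℕ →₀ A) : lmul σ δ (Finsupp.single 0 1) f = f := by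
  rw [lmul_single]; simp

noncomputable instance instRing : Ring (OreExtension σ δ) :=
  { instAddCommGroup σ δ with
    mul := fun f g => lmul σ δ f g
    one := Finsupp.single 0 (1 : A)
    left_distrib := fun f g h => map_add (lmul σ δ f) g h
    right_distrib := fun f g h => LinearMap.congr_fun (map_add (lmul σ δ) f g) h
    zero_mul := fun f => LinearMap.congr_fun (map_zero (lmul σ δ)) f
    mul_zero := fun f => map_zero (lmul σ δ f)
    mul_assoc := fun f g h => lmul_lmul σ δ f g h
    one_mul := fun f => lmul_one_left σ δ f
    mul_one := fun f => lmul_one_right σ δ f }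

noncomputable instance instAlgebra : Algebra k (OreExtension σ δ) :=
  Algebra.ofModule
    (fun c f g => LinearMap.congr_fun (map_smul (lmul σ δ) c f) g)
    (fun c f g => map_smul (lmul σ δ f) c g)

/-- The inclusion `A → A[x, σ, δ]`, as constant polynomials. -/
noncomputable def C : A →ₐ[k] OreExtension σ δ :=
  AlgHom.ofLinearMap (Finsupp.lsingle 0 : A →ₗ[k] (ℕ →₀ A)) rfl fun a b => by
    change Finsupp.single 0 (a * b) = lmul σ δ (Finsupp.single 0 a) (Finsupp.single 0 b)
    rw [lmul_single]; simp

/-- The variable `x` of `A[x, σ, δ]`. -/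
noncomputable def X : OreExtension σ δ := (Finsupp.single 1 (1 : A) : ℕ →₀ A)

/-- The defining relation of the Ore extension. -/
theorem X_mul_C (a : A) :
    X σ δ * C σ δ a = C σ δ (σ a) * X σ δ + C σ δ (δ.toLinearMap a) := by
  have h : lmul σ δ (Finsupp.single 1 1) (Finsupp.single 0 a) =
      lmul σ δ (Finsupp.single 0 (σ a)) (Finsupp.single 1 1) +
        Finsupp.single 0 (δ.toLinearMap a) := by
    rw [lmul_single, lmul_single, pow_one, shift_single]
    simp
  exact h

/-- The sequence supported at `i` with value `a` is the monomial `a xⁱ`. -/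
theorem C_mul_X_pow (a : A) (i : ℕ) :
    C σ δ a * X σ δ ^ i = (Finsupp.single i a : ℕ →₀ A) := by
  have hX : ∀ i : ℕ, X σ δ ^ i = (Finsupp.single i (1 : A) : ℕ →₀ A) := by
    intro i
    induction i with
    | zero => rfl
    | succ i ih =>
      rw [pow_succ', ih]
      change lmul σ δ (Finsupp.single 1 1) (Finsupp.single i 1) = _
      rw [lmul_single, ← shift_pow_one σ δ i, one_smul, ← Module.End.mul_apply, pow_one,
        ← pow_succ', shift_pow_one]
  rw [hX]
  change lmul σ δ (Finsupp.single 0 a) (Finsupp.single i 1) = _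
  rw [lmul_single]; simp

end

end OreExtension

/-- The Hopf algebra `H`, whose underlying algebra is identified with `A[x, σ, δ]` by `e`, is a
Hopf-Ore extension of the Hopf algebra `A`: the Hopf algebra structure of `H` extends the one of
`A`, and `Δ(x) = x ⊗ 1 + g ⊗ x` for some grouplike `g ∈ A`. (A homomorphism of bialgebras
between Hopf algebras automatically commutes with the antipodes.) -/
structure IsHopfOreExtension {k : Type u} {A : Type v} [Field k] [Ring A] [HopfAlgebra k A]
    {σ : A ≃ₐ[k] A} {δ : SkewDerivation σ} {H : Type w} [Ring H] [HopfAlgebra k H]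
    (e : OreExtension σ δ ≃ₐ[k] H) : Prop where
  counit_C : ∀ a : A,
    Coalgebra.counit (R := k) (e (OreExtension.C σ δ a)) = Coalgebra.counit (R := k) a
  comul_C : ∀ a : A,
    Coalgebra.comul (R := k) (e (OreExtension.C σ δ a)) =
      TensorProduct.map (e.toLinearMap ∘ₗ (OreExtension.C σ δ).toLinearMap)
        (e.toLinearMap ∘ₗ (OreExtension.C σ δ).toLinearMap) (Coalgebra.comul (R := k) a)
  comul_X : ∃ g : A, IsGroupLikeElem k g ∧
    Coalgebra.comul (R := k) (e (OreExtension.X σ δ)) =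
      e (OreExtension.X σ δ) ⊗ₜ[k] (1 : H) +
        e (OreExtension.C σ δ g) ⊗ₜ[k] e (OreExtension.X σ δ)

/-- `sweedlerMul f g h = f(h₁) g(h₂)`, in Sweedler notation `Δ(h) = h₁ ⊗ h₂`. -/
noncomputable def sweedlerMul {k : Type u} {H : Type v} {R : Type w} [Field k] [Ring H]
    [HopfAlgebra k H] [Ring R] [Algebra k R] (f g : H →ₗ[k] R) (h : H) : R :=
  LinearMap.mul' k R (TensorProduct.map f g (Coalgebra.comul (R := k) h))

/-- A (left) partial action of the Hopf algebra `H` on the algebra `R`; the map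
`H ⊗ R → R`, `h ⊗ r ↦ h · r`, is given in curried form, `h · r = act h r`. -/
structure IsPartialAction {k : Type u} {H : Type v} {R : Type w} [Field k] [Ring H]
    [HopfAlgebra k H] [Ring R] [Algebra k R] (act : H →ₗ[k] R →ₗ[k] R) : Prop where
  /-- `1 · r = r` -/
  one_act : ∀ r : R, act 1 r = r
  /-- `h · (r s) = (h₁ · r) (h₂ · s)` -/
  act_mul : ∀ (h : H) (r s : R), act h (r * s) = sweedlerMul (act.flip r) (act.flip s) h
  /-- `h · (l · r) = (h₁ · 1) (h₂ l · r)` -/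
  act_act : ∀ (h l : H) (r : R),
    act h (act l r) = sweedlerMul (act.flip 1) (act.flip r ∘ₗ LinearMap.mulRight k l) h

/-- A symmetric partial action: a partial action with `h · (l · r) = (h₁ l · r) (h₂ · 1)`. -/
structure IsSymmetricPartialAction {k : Type u} {H : Type v} {R : Type w} [Field k] [Ring H]
    [HopfAlgebra k H] [Ring R] [Algebra k R] (act : H →ₗ[k] R →ₗ[k] R) : Prop
    extends IsPartialAction act where
  act_act_symm : ∀ (h l : H) (r : R),
    act h (act l r) = sweedlerMul (act.flip r ∘ₗ LinearMap.mulRight k l) (act.flip 1) h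

/-- The map `▷ : A[x, σ, δ] ⊗ R → R` satisfies `xʲ a ▷ r = δ_{j,0} (a · r)` for all `j ≥ 0`,
`a ∈ A`, `r ∈ R`, where `δ_{j,0}` is the Kronecker delta. -/
def IsTrivialExtension {k : Type u} {A : Type v} [Field k] [Ring A] [HopfAlgebra k A]
    {σ : A ≃ₐ[k] A} {δ : SkewDerivation σ} {H : Type w} [Ring H] [HopfAlgebra k H]
    (e : OreExtension σ δ ≃ₐ[k] H) {R : Type*} [Ring R] [Algebra k R]
    (act : A →ₗ[k] R →ₗ[k] R) (ext : H →ₗ[k] R →ₗ[k] R) : Prop :=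
  ∀ (j : ℕ) (a : A) (r : R),
    ext (e (OreExtension.X σ δ) ^ j * e (OreExtension.C σ δ a)) r =
      if j = 0 then act a r else 0

/-! Write `H` for `A[x, σ, δ]`. As `σ` is invertible, `a x = x σ⁻¹(a) - δ(σ⁻¹(a))`, so powers of `x`
can be moved to the left and `H = A ⊕ xH`. The required map has to be `act` after the projection
`constCoeff` onto `A`; it kills the right ideal `xH`. The axioms for `h ▷ _` are additive in `h`, so
it suffices to take `h` in `A` or in `xH`. On `xH` both sides vanish: each term of `Δ(xh) = (x ⊗ 1 +
g ⊗ x) Δ(h)` has a leg in `xH` (`sweedlerMul_skewPrimitive_mul`). On `A` they become the axioms of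
`act`, once `al ▷ r = a · (l ▷ r)` is replaced by the correct `al ▷ r = (a l₀) · r`, where `l₀` is
the constant coefficient of `l`. This holds because `constCoeff` is left `A`-linear modulo `J`
(`constCoeff_C_mul_sub_mem`) and `J` acts by zero. -/

namespace OreExtension

/-! ### The projection of the Ore extension onto constants along `xH` -/

section

variable {k : Type u} {A : Type v} [Field k] [Ring A] [Algebra k A]
  (σ : A ≃ₐ[k] A) (δ : SkewDerivation σ)

/-- The map `a ↦ -δ(σ⁻¹(a))`, which describes `a x` modulo the right ideal generated by `x`. -/
noncomputable def residue : Module.End k A :=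
  -(δ.toLinearMap ∘ₗ σ.symm.toLinearMap)

theorem residue_apply (a : A) : residue σ δ a = -δ.toLinearMap (σ.symm a) := rfl

/-- The constant coefficient when the powers of `x` are written on the left:
`∑ xⁱ aᵢ ↦ a₀`. -/
noncomputable def constCoeff : OreExtension σ δ →ₗ[k] A :=
  (Finsupp.lsum k fun i => residue σ δ ^ i : (ℕ →₀ A) →ₗ[k] A)

theorem constCoeff_C_mul_X_pow (a : A) (i : ℕ) :
    constCoeff σ δ (C σ δ a * X σ δ ^ i) = (residue σ δ ^ i) a := by
  rw [C_mul_X_pow]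
  exact Finsupp.lsum_single _ _ _ _

theorem constCoeff_C (a : A) : constCoeff σ δ (C σ δ a) = a := by
  simpa using constCoeff_C_mul_X_pow σ δ a 0

theorem induction_C_mul_X_pow {P : OreExtension σ δ → Prop}
    (add : ∀ f g, P f → P g → P (f + g))
    (monomial : ∀ a i, P (C σ δ a * X σ δ ^ i)) (f : OreExtension σ δ) : P f := by
  refine Finsupp.induction_linear (motive := P) f ?_ add fun i a => ?_
  · have h := monomial 0 0
    rwa [map_zero, zero_mul] at h
  · have h := monomial a i
    rwa [C_mul_X_pow] at h

/-- In `x a xⁱ = σ(a) xⁱ⁺¹ + δ(a) xⁱ` the two terms cancel under the projection, since `residue`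
sends `σ(a)` to `-δ(a)`. -/
theorem constCoeff_X_mul (f : OreExtension σ δ) : constCoeff σ δ (X σ δ * f) = 0 := by
  induction f using induction_C_mul_X_pow with
  | add f g hf hg => rw [mul_add, map_add, hf, hg, add_zero]
  | monomial a i =>
    rw [← mul_assoc, X_mul_C, add_mul, mul_assoc, ← pow_succ', map_add,
      constCoeff_C_mul_X_pow, constCoeff_C_mul_X_pow, pow_succ, Module.End.mul_apply,
      residue_apply, AlgEquiv.symm_apply_apply, map_neg, neg_add_cancel]

theorem residue_pow_succ_mem (a : A) (i : ℕ) :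
    (residue σ δ ^ (i + 1)) a ∈ TwoSidedIdeal.span (Set.range δ.toLinearMap) := by
  rw [pow_succ', Module.End.mul_apply, residue_apply]
  exact neg_mem (TwoSidedIdeal.subset_span ⟨_, rfl⟩)

/-- Modulo the two-sided ideal generated by `δ(A)`, the constant coefficient is left `A`-linear. -/
theorem constCoeff_C_mul_sub_mem (a : A) (f : OreExtension σ δ) :
    constCoeff σ δ (C σ δ a * f) - a * constCoeff σ δ f ∈
      TwoSidedIdeal.span (Set.range δ.toLinearMap) := by
  induction f using induction_C_mul_X_pow with
  | add f g hf hg =>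
    rw [mul_add, map_add, map_add, mul_add, add_sub_add_comm]
    exact add_mem hf hg
  | monomial b i =>
    rw [← mul_assoc, ← map_mul, constCoeff_C_mul_X_pow, constCoeff_C_mul_X_pow]
    cases i with
    | zero => simp [zero_mem]
    -- For a positive power of `x`, the two terms of the difference lie in the ideal separately.
    | succ i =>
      exact sub_mem (residue_pow_succ_mem σ δ _ i)
        (TwoSidedIdeal.mul_mem_left _ _ _ (residue_pow_succ_mem σ δ _ i))

/-- Induction along `H = A + xH`: surjectivity of `σ` lets one factor `x` pass to the left of any
coefficient, leaving a remainder of lower degree. -/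
theorem induction_X_mul {P : OreExtension σ δ → Prop}
    (add : ∀ f g, P f → P g → P (f + g)) (const : ∀ a, P (C σ δ a))
    (X_mul : ∀ f, P f → P (X σ δ * f)) (f : OreExtension σ δ) : P f := by
  induction f using induction_C_mul_X_pow with
  | add f g hf hg => exact add f g hf hg
  | monomial a i =>
    induction i generalizing a with
    | zero => simpa using const a
    | succ i ih =>
      have h : C σ δ a * X σ δ ^ (i + 1) =
          X σ δ * (C σ δ (σ.symm a) * X σ δ ^ i) + C σ δ (residue σ δ a) * X σ δ ^ i := by
        rw [← mul_assoc, X_mul_C, AlgEquiv.apply_symm_apply, residue_apply, map_neg, add_mul,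
          mul_assoc, ← pow_succ', neg_mul, add_neg_cancel_right]
      rw [h]
      exact add _ _ (X_mul _ (ih _)) (ih _)

end

end OreExtension

/-! ### Convolution of functionals vanishing on `xH` -/

section

variable {k : Type u} {H : Type v} {R : Type w} [Field k] [Ring H] [HopfAlgebra k H] [Ring R]
  [Algebra k R]

theorem sweedlerMul_add (f g : H →ₗ[k] R) (h h' : H) :
    sweedlerMul f g (h + h') = sweedlerMul f g h + sweedlerMul f g h' := by
  simp [sweedlerMul]

/-- If `Δ(x) = x ⊗ 1 + g ⊗ x` and two functionals vanish on `x H`, so does their convolution. -/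
theorem sweedlerMul_skewPrimitive_mul {x g : H}
    (hx : Coalgebra.comul (R := k) x = x ⊗ₜ[k] (1 : H) + g ⊗ₜ[k] x) {φ ψ : H →ₗ[k] R}
    (hφ : ∀ h, φ (x * h) = 0) (hψ : ∀ h, ψ (x * h) = 0) (h : H) :
    sweedlerMul φ ψ (x * h) = 0 := by
  rw [sweedlerMul, Bialgebra.comul_mul, hx]
  induction Coalgebra.comul (R := k) h using TensorProduct.induction_on with
  | zero => simp
  | add s t hs ht => rw [mul_add, map_add, map_add, hs, ht, add_zero]
  -- `φ` kills the left leg of `xa ⊗ b`, and `ψ` the right leg of `ga ⊗ xb`.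
  | tmul a b => simp [add_mul, hφ, hψ]

end

/-! ### The extended partial action -/

namespace IsHopfOreExtension

open OreExtension

variable {k : Type*} {A : Type*} [Field k] [Ring A] [HopfAlgebra k A]
  {σ : A ≃ₐ[k] A} {δ : SkewDerivation σ} {H : Type*} [Ring H] [HopfAlgebra k H]
  {R : Type*} [Ring R] [Algebra k R]

theorem sweedlerMul_C {e : OreExtension σ δ ≃ₐ[k] H} (he : IsHopfOreExtension e)
    (φ ψ : H →ₗ[k] R) (a : A) :
    sweedlerMul φ ψ (e (C σ δ a)) =
      sweedlerMul (φ ∘ₗ e.toLinearMap ∘ₗ (C σ δ).toLinearMap)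
        (ψ ∘ₗ e.toLinearMap ∘ₗ (C σ δ).toLinearMap) a := by
  simp only [sweedlerMul, he.comul_C, TensorProduct.map_comp, LinearMap.comp_apply]

theorem induction_X_mul (e : OreExtension σ δ ≃ₐ[k] H) {P : H → Prop}
    (add : ∀ h h', P h → P h' → P (h + h')) (const : ∀ a, P (e (C σ δ a)))
    (X_mul : ∀ h, P h → P (e (X σ δ) * h)) (h : H) : P h := by
  obtain ⟨f, rfl⟩ := e.surjective h
  induction f using OreExtension.induction_X_mul with
  | add f g hf hg => rw [map_add]; exact add _ _ hf hg
  | const a => exact const a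
  | X_mul f hf => rw [map_mul]; exact X_mul _ hf

/-- The map `A[x, σ, δ] ⊗ R → R` with `xʲ a ▷ r = 0` for `j ≥ 1` and `a ▷ r = a · r`. -/
noncomputable def trivialExtension (e : OreExtension σ δ ≃ₐ[k] H) (act : A →ₗ[k] R →ₗ[k] R) :
    H →ₗ[k] R →ₗ[k] R :=
  act ∘ₗ constCoeff σ δ ∘ₗ e.symm.toLinearMap

section

variable (e : OreExtension σ δ ≃ₐ[k] H) (act : A →ₗ[k] R →ₗ[k] R)

theorem trivialExtension_apply (h : H) :
    trivialExtension e act h = act (constCoeff σ δ (e.symm h)) := rfl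

theorem trivialExtension_C (a : A) : trivialExtension e act (e (C σ δ a)) = act a := by
  rw [trivialExtension_apply, AlgEquiv.symm_apply_apply, constCoeff_C]

theorem trivialExtension_X_mul (h : H) : trivialExtension e act (e (X σ δ) * h) = 0 := by
  rw [trivialExtension_apply, map_mul, AlgEquiv.symm_apply_apply, constCoeff_X_mul, map_zero]

theorem isTrivialExtension_trivialExtension :
    IsTrivialExtension e act (trivialExtension e act) := by
  intro j a r
  cases j with
  | zero => simp [trivialExtension_C]
  | succ j =>
    rw [pow_succ', mul_assoc, trivialExtension_X_mul, if_neg j.succ_ne_zero,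
      LinearMap.zero_apply]

variable {e act}

theorem isTrivialExtension_unique {ext ext' : H →ₗ[k] R →ₗ[k] R}
    (h : IsTrivialExtension e act ext) (h' : IsTrivialExtension e act ext') : ext' = ext := by
  -- Quantifying over `j` lets the power absorb the factor `x` split off in the induction.
  have key : ∀ y : H, ∀ j : ℕ, ext' (e (X σ δ) ^ j * y) = ext (e (X σ δ) ^ j * y) := by
    intro y
    induction y using induction_X_mul e with
    | add y z hy hz => intro j; rw [mul_add, map_add, map_add, hy, hz]
    | const a => intro j; ext r; rw [h, h']
    | X_mul y hy => intro j; rw [← mul_assoc, ← pow_succ, hy]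
  ext1 y
  simpa using key y 0

/-- This is where `J · R = 0` is needed: the error in the left `A`-linearity of `constCoeff` lies in
`J`. -/
theorem trivialExtension_C_mul
    (hJ : ∀ a ∈ TwoSidedIdeal.span (Set.range δ.toLinearMap), ∀ r : R, act a r = 0)
    (a : A) (h : H) :
    trivialExtension e act (e (C σ δ a) * h) = act (a * constCoeff σ δ (e.symm h)) := by
  ext r
  rw [trivialExtension_apply, map_mul, AlgEquiv.symm_apply_apply, ← sub_eq_zero,
    ← LinearMap.sub_apply, ← map_sub]
  exact hJ _ (constCoeff_C_mul_sub_mem σ δ a _) r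

theorem flip_trivialExtension_comp_C (r : R) :
    (trivialExtension e act).flip r ∘ₗ e.toLinearMap ∘ₗ (C σ δ).toLinearMap = act.flip r := by
  ext a
  exact LinearMap.congr_fun (trivialExtension_C e act a) r

/-- Turns the convolution for `h ▷ (l ▷ r)` at a constant `h` into the one for `act`, with `l`
replaced by its constant coefficient. -/
theorem flip_trivialExtension_comp_mulRight_comp_C
    (hJ : ∀ a ∈ TwoSidedIdeal.span (Set.range δ.toLinearMap), ∀ r : R, act a r = 0)
    (l : H) (r : R) :
    ((trivialExtension e act).flip r ∘ₗ LinearMap.mulRight k l) ∘ₗ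
        e.toLinearMap ∘ₗ (C σ δ).toLinearMap =
      act.flip r ∘ₗ LinearMap.mulRight k (constCoeff σ δ (e.symm l)) := by
  ext a
  exact LinearMap.congr_fun (trivialExtension_C_mul hJ a l) r

theorem flip_trivialExtension_X_mul (r : R) (h : H) :
    (trivialExtension e act).flip r (e (X σ δ) * h) = 0 :=
  LinearMap.congr_fun (trivialExtension_X_mul e act h) r

/-- Right multiplication by `l` preserves the right ideal `xH`. -/
theorem flip_trivialExtension_mulRight_X_mul (r : R) (l h : H) :
    ((trivialExtension e act).flip r ∘ₗ LinearMap.mulRight k l) (e (X σ δ) * h) = 0 := by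
  rw [LinearMap.comp_apply, LinearMap.mulRight_apply, mul_assoc, flip_trivialExtension_X_mul]

theorem isPartialAction_trivialExtension (he : IsHopfOreExtension e) (hact : IsPartialAction act)
    (hJ : ∀ a ∈ TwoSidedIdeal.span (Set.range δ.toLinearMap), ∀ r : R, act a r = 0) :
    IsPartialAction (trivialExtension e act) := by
  obtain ⟨g, -, hX⟩ := he.comul_X
  refine ⟨fun r => ?_, fun h r s => ?_, fun h l r => ?_⟩
  · have h1 := trivialExtension_C e act 1
    rw [map_one, map_one] at h1
    rw [h1, hact.one_act]
  · induction h using induction_X_mul e with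
    | add h h' hh hh' => rw [map_add, LinearMap.add_apply, hh, hh', sweedlerMul_add]
    | const a =>
      rw [trivialExtension_C, he.sweedlerMul_C, flip_trivialExtension_comp_C,
        flip_trivialExtension_comp_C, hact.act_mul]
    | X_mul h _ =>
      rw [trivialExtension_X_mul, LinearMap.zero_apply, sweedlerMul_skewPrimitive_mul hX
        (flip_trivialExtension_X_mul r) (flip_trivialExtension_X_mul s)]
  · induction h using induction_X_mul e with
    | add h h' hh hh' => rw [map_add, LinearMap.add_apply, hh, hh', sweedlerMul_add]
    | const a =>
      rw [trivialExtension_C, he.sweedlerMul_C, flip_trivialExtension_comp_C,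
        flip_trivialExtension_comp_mulRight_comp_C hJ, trivialExtension_apply, hact.act_act]
    | X_mul h _ =>
      rw [trivialExtension_X_mul, LinearMap.zero_apply, sweedlerMul_skewPrimitive_mul hX
        (flip_trivialExtension_X_mul 1) (flip_trivialExtension_mulRight_X_mul r l)]

theorem isSymmetricPartialAction_trivialExtension (he : IsHopfOreExtension e)
    (hact : IsSymmetricPartialAction act)
    (hJ : ∀ a ∈ TwoSidedIdeal.span (Set.range δ.toLinearMap), ∀ r : R, act a r = 0) :
    IsSymmetricPartialAction (trivialExtension e act) := by
  obtain ⟨g, -, hX⟩ := he.comul_X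
  refine ⟨isPartialAction_trivialExtension he hact.toIsPartialAction hJ, fun h l r => ?_⟩
  induction h using induction_X_mul e with
  | add h h' hh hh' => rw [map_add, LinearMap.add_apply, hh, hh', sweedlerMul_add]
  | const a =>
    rw [trivialExtension_C, he.sweedlerMul_C, flip_trivialExtension_comp_C,
      flip_trivialExtension_comp_mulRight_comp_C hJ, trivialExtension_apply, hact.act_act_symm]
  | X_mul h _ =>
    rw [trivialExtension_X_mul, LinearMap.zero_apply, sweedlerMul_skewPrimitive_mul hX
      (flip_trivialExtension_mulRight_X_mul r l) (flip_trivialExtension_X_mul 1)]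

end

end IsHopfOreExtension

theorem SkewDerivation.span_range_zero {k : Type u} {A : Type v} [Field k] [Ring A] [Algebra k A]
    (σ : A ≃ₐ[k] A) :
    TwoSidedIdeal.span (Set.range (0 : SkewDerivation σ).toLinearMap) = ⊥ := by
  rw [eq_bot_iff, TwoSidedIdeal.span_le]
  rintro _ ⟨a, rfl⟩
  exact zero_mem (⊥ : TwoSidedIdeal A)

theorem mainTheorem10 {k : Type*} [Field k] {A : Type*} [Ring A] [HopfAlgebra k A]
    {R : Type*} [Ring R] [Algebra k R] (act : A →ₗ[k] R →ₗ[k] R) (hact : IsPartialAction act) :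
    -- the general case: `J` is the two-sided ideal generated by `δ(A)`, and `J · R = 0`
    (∀ (σ : A ≃ₐ[k] A) (δ : SkewDerivation σ) (H : Type*) [Ring H] [HopfAlgebra k H]
        (e : OreExtension σ δ ≃ₐ[k] H), IsHopfOreExtension e →
      (∀ a ∈ TwoSidedIdeal.span (Set.range δ.toLinearMap), ∀ r : R, act a r = 0) →
      ∃ ext : H →ₗ[k] R →ₗ[k] R,
        IsTrivialExtension e act ext ∧
        (∀ ext' : H →ₗ[k] R →ₗ[k] R, IsTrivialExtension e act ext' → ext' = ext) ∧
        IsPartialAction ext ∧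
        (IsSymmetricPartialAction act → IsSymmetricPartialAction ext)) ∧
    -- the case `δ = 0`
    (∀ (σ : A ≃ₐ[k] A) (H : Type*) [Ring H] [HopfAlgebra k H]
        (e : OreExtension σ (0 : SkewDerivation σ) ≃ₐ[k] H), IsHopfOreExtension e →
      ∃ ext : H →ₗ[k] R →ₗ[k] R,
        IsTrivialExtension e act ext ∧
        (∀ ext' : H →ₗ[k] R →ₗ[k] R, IsTrivialExtension e act ext' → ext' = ext) ∧
        IsPartialAction ext ∧
        (IsSymmetricPartialAction act → IsSymmetricPartialAction ext)) := by
  open IsHopfOreExtension in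
  refine ⟨fun σ δ H _ _ e he hJ => ?_, fun σ H _ _ e he => ?_⟩
  · exact ⟨trivialExtension e act, isTrivialExtension_trivialExtension e act,
      fun _ => isTrivialExtension_unique (isTrivialExtension_trivialExtension e act),
      isPartialAction_trivialExtension he hact hJ,
      fun hsymm => isSymmetricPartialAction_trivialExtension he hsymm hJ⟩
  · have hJ : ∀ a ∈ TwoSidedIdeal.span (Set.range (0 : SkewDerivation σ).toLinearMap),
        ∀ r : R, act a r = 0 := by
      intro a ha r
      rw [SkewDerivation.span_range_zero, TwoSidedIdeal.mem_bot] at ha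
      rw [ha, map_zero, LinearMap.zero_apply]
    exact ⟨trivialExtension e act, isTrivialExtension_trivialExtension e act,
      fun _ => isTrivialExtension_unique (isTrivialExtension_trivialExtension e act),
      isPartialAction_trivialExtension he hact hJ,
      fun hsymm => isSymmetricPartialAction_trivialExtension he hsymm hJ⟩
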